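/- Let $(k_n)_{n\ge 0}$ be a sequence of positive real numbers, and let $\mathcal R_k$ be the Hilbert space of power series $f(z)=\sum_{n\ge 0} f_n z^n$ with complex coefficients and finite norm $\|f\|=\big(\sum_{n\ge 0}|f_n|^2/k_n\big)^{1/2}$. Assume that $\mathcal R_k$ is a Banach algebra with respect to the multiplication of power series (that is, $fg\in\mathcal R_k$ and $\|fg\|\le C\|f\|\,\|g\|$ for all $f,g\in\mathcal R_k$, with a constant $C$ independent of $f$ and $g$), and that $$\lim_{n\to\infty}\Big(\inf_{j\ge 0}\frac{k_j}{k_{n+j}}\Big)^{1/n}=\lim_{n\to\infty}k_n^{1/n}=1 .$$ Let $d$ be a non-negative integer, let $\mathcal R_k^d$ be the direct sum of $d$ copies of $\mathcal R_k$, and let $M_z f=zf$ be the (bounded) operator of multiplication by $z$ on $\mathcal R_k^d$. Let $\mathbb D$ be the open unit disc. For a closed subspace $\mathcal J\subset\mathcal R_k^d$ with $M_z\mathcal J\subset\mathcal J$, define the spectrum of $\mathcal J$ by $$\sigma(\mathcal J)=\big\{\lambda\in\overline{\mathbb D}:\ \{g(\lambda):g\in\mathcal J\}\ne\mathbb C^d\big\},$$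 and let $\sigma(\mathcal M_z)$ be the spectrum of the bounded operator $\mathcal M_z[f]=[zf]$ on the quotient space $\mathcal R_k^d/\mathcal J$. Then, for every closed $M_z$-invariant subspace $\mathcal J$ of $\mathcal R_k^d$, $$\sigma(\mathcal J)\cap\mathbb D=\sigma(\mathcal M_z)\cap\mathbb D .$$ -/

import Mathlib

open Filter Topology

noncomputable section

/-- A sequence `k 0, k 1, k 2, …` of (strictly) positive real numbers. -/
structure WeightSeq where
  /-- the `n`-th term -/
  coeff : ℕ → ℝ
  pos : ∀ n, 0 < coeff n

instance : CoeFun WeightSeq (fun _ => ℕ → ℝ) := ⟨WeightSeq.coeff⟩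

/-- The space `R_k` of the power series `f = ∑ f_n z^n` with `∑ |f_n|² / k_n < ∞`. -/
def Rk (k : WeightSeq) : Submodule ℂ (PowerSeries ℂ) where
  carrier := {f | Summable fun n => ‖PowerSeries.coeff n f‖ ^ 2 / k n}
  zero_mem' := by simp [summable_zero]
  add_mem' := by
    intro f g hf hg
    refine Summable.of_nonneg_of_le (fun n => div_nonneg (sq_nonneg _) (k.pos n).le) (fun n => ?_)
      ((hf.add hg).mul_left 2)
    rw [← add_div, ← mul_div_assoc]
    refine div_le_div_of_nonneg_right ?_ (k.pos n).le
    have h := norm_add_le (PowerSeries.coeff n f) (PowerSeries.coeff n g)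
    rw [map_add]
    nlinarith [sq_nonneg (‖PowerSeries.coeff n f‖ - ‖PowerSeries.coeff n g‖),
      norm_nonneg (PowerSeries.coeff n f + PowerSeries.coeff n g)]
  smul_mem' := by
    intro c f hf
    refine (Summable.mul_left (‖c‖ ^ 2) hf).congr (fun n => ?_)
    simp [mul_pow, mul_div_assoc]

namespace Rk

variable {k : WeightSeq}

/-- The map `f ↦ (f_n / √k_n)_n` from `R_k` to `ℓ²`; the norm of `R_k` is the one that makes
it isometric. -/
def toL2 (k : WeightSeq) : Rk k →ₗ[ℂ] lp (fun _ : ℕ => ℂ) 2 where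
  toFun f := ⟨fun n => PowerSeries.coeff n f.1 / (Real.sqrt (k n) : ℂ), by
    refine memℓp_gen ?_
    refine Summable.congr f.2 (fun n => ?_)
    have h : ‖(Real.sqrt (k n) : ℂ)‖ ^ 2 = k n := by
      rw [Complex.norm_real, Real.norm_eq_abs, sq_abs, Real.sq_sqrt (k.pos n).le]
    simp [-Complex.norm_real, div_pow, h]⟩
  map_add' f g := by
    ext n
    exact (congrArg (· / (Real.sqrt (k n) : ℂ)) (map_add (PowerSeries.coeff n) f.1 g.1)).trans
      (add_div _ _ _)
  map_smul' c f := by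
    ext n
    simp [mul_div_assoc]

theorem toL2_injective (k : WeightSeq) : Function.Injective (toL2 k) := by
  intro f g h
  apply Subtype.ext
  ext n
  have h1 := congrArg (fun a : lp (fun _ : ℕ => ℂ) 2 => (a : ℕ → ℂ) n) h
  have h2 : (Real.sqrt (k n) : ℂ) ≠ 0 :=
    Complex.ofReal_ne_zero.2 (Real.sqrt_pos.2 (k.pos n)).ne'
  exact (div_left_inj' h2).1 h1

instance : NormedAddCommGroup (Rk k) :=
  NormedAddCommGroup.induced (Rk k) (lp (fun _ : ℕ => ℂ) 2) (toL2 k) (toL2_injective k)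

instance : NormedSpace ℂ (Rk k) :=
  NormedSpace.induced ℂ (Rk k) (lp (fun _ : ℕ => ℂ) 2) (toL2 k)

/-- The norm of `R_k` is `(∑ |f_n|² / k_n)^{1/2}`. -/
theorem norm_eq (f : Rk k) :
    ‖f‖ = Real.sqrt (∑' n, ‖PowerSeries.coeff n (f : PowerSeries ℂ)‖ ^ 2 / k n) := by
  have h0 : ‖f‖ = ‖toL2 k f‖ := rfl
  have h := lp.norm_rpow_eq_tsum (p := 2) (by norm_num) (toL2 k f)
  have h1 : ‖toL2 k f‖ ^ 2
      = ∑' n, ‖PowerSeries.coeff n (f : PowerSeries ℂ)‖ ^ 2 / k n := by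
    simp only [ENNReal.toReal_ofNat, Real.rpow_ofNat] at h
    rw [h]
    refine tsum_congr (fun n => ?_)
    have h2 : ‖(Real.sqrt (k n) : ℂ)‖ ^ 2 = k n := by
      rw [Complex.norm_real, Real.norm_eq_abs, sq_abs, Real.sq_sqrt (k.pos n).le]
    simp [toL2, -Complex.norm_real, div_pow, h2]
  rw [← h1, h0, Real.sqrt_sq (norm_nonneg _)]

/-- The value `f(lam) = ∑ f_n lam^n`. -/
def eval (lam : ℂ) (f : Rk k) : ℂ := ∑' n, PowerSeries.coeff n (f : PowerSeries ℂ) * lam ^ n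

/-- The power series `z` belongs to `R_k`. -/
theorem X_mem (k : WeightSeq) : (PowerSeries.X : PowerSeries ℂ) ∈ Rk k := by
  refine summable_of_ne_finset_zero (s := {1}) (fun n hn => ?_)
  have : n ≠ 1 := by simpa using hn
  simp [PowerSeries.coeff_X, this]

end Rk

/-- `R_k` is a Banach algebra with respect to the multiplication of power series (up to passing
to an equivalent norm): it is closed under this multiplication, which is bounded. -/
def IsBanachAlgebraRk (k : WeightSeq) : Prop :=
  ∃ C : ℝ, ∀ f g : Rk k, ∃ h : Rk k,
    (h : PowerSeries ℂ) = (f : PowerSeries ℂ) * (g : PowerSeries ℂ) ∧ ‖h‖ ≤ C * ‖f‖ * ‖g‖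

variable {k : WeightSeq}

theorem IsBanachAlgebraRk.X_mul_mem (hk : IsBanachAlgebraRk k) (f : Rk k) :
    PowerSeries.X * (f : PowerSeries ℂ) ∈ Rk k := by
  obtain ⟨C, hC⟩ := hk
  obtain ⟨h, hh, -⟩ := hC ⟨PowerSeries.X, Rk.X_mem k⟩ f
  have : (h : PowerSeries ℂ) = PowerSeries.X * (f : PowerSeries ℂ) := hh
  exact this ▸ h.2

/-- The bounded operator `M_z : f ↦ z f` on `R_k`. -/
def Mz (hk : IsBanachAlgebraRk k) : Rk k →L[ℂ] Rk k :=
  LinearMap.mkContinuousOfExistsBound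
    { toFun := fun f => ⟨PowerSeries.X * (f : PowerSeries ℂ), hk.X_mul_mem f⟩
      map_add' := fun f g => Subtype.ext (mul_add _ _ _)
      map_smul' := fun c f => Subtype.ext (mul_smul_comm _ _ _) }
    (by
      obtain ⟨C, hC⟩ := hk
      refine ⟨C * ‖(⟨PowerSeries.X, Rk.X_mem k⟩ : Rk k)‖, fun f => ?_⟩
      obtain ⟨h, hh, hn⟩ := hC ⟨PowerSeries.X, Rk.X_mem k⟩ f
      refine le_trans (le_of_eq ?_) hn
      exact congrArg norm (Subtype.ext hh.symm))

/-- The Hilbert direct sum `R_k^d` of `d` copies of `R_k`. -/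
abbrev RkPow (k : WeightSeq) (d : ℕ) : Type := PiLp 2 (fun _ : Fin d => Rk k)

/-- The operator `M_z : f ↦ z f` on `R_k^d`, acting in each component. -/
def MzPow (hk : IsBanachAlgebraRk k) (d : ℕ) : RkPow k d →L[ℂ] RkPow k d :=
  ((PiLp.continuousLinearEquiv 2 ℂ (fun _ : Fin d => Rk k)).symm :
      ((i : Fin d) → Rk k) →L[ℂ] RkPow k d) ∘L
    ContinuousLinearMap.piMap (fun _ : Fin d => Mz hk) ∘L
    (PiLp.continuousLinearEquiv 2 ℂ (fun _ : Fin d => Rk k) :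
      RkPow k d →L[ℂ] ((i : Fin d) → Rk k))

theorem MzPow_apply (hk : IsBanachAlgebraRk k) (d : ℕ) (f : RkPow k d) (i : Fin d) :
    ((MzPow hk d f i : Rk k) : PowerSeries ℂ) = PowerSeries.X * (f i : PowerSeries ℂ) := rfl

/-- The quotient operator `[f] ↦ [z f]` on `R_k^d / J`, for an `M_z`-invariant subspace `J`. -/
def quotMz (hk : IsBanachAlgebraRk k) {d : ℕ} (J : Submodule ℂ (RkPow k d))
    (hJ : ∀ f ∈ J, MzPow hk d f ∈ J) : (RkPow k d ⧸ J) →L[ℂ] (RkPow k d ⧸ J) :=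
  J.liftQL (J.mkQL ∘L MzPow hk d) (fun f hf => by
    simpa using hJ f hf)

theorem quotMz_mk (hk : IsBanachAlgebraRk k) {d : ℕ} (J : Submodule ℂ (RkPow k d))
    (hJ : ∀ f ∈ J, MzPow hk d f ∈ J) (f : RkPow k d) :
    quotMz hk J hJ (J.mkQ f) = J.mkQ (MzPow hk d f) := rfl

/-- The fiber `{ g(lam) : g ∈ J }` of `J` over `lam`. -/
def fiber {d : ℕ} (J : Submodule ℂ (RkPow k d)) (lam : ℂ) : Set (Fin d → ℂ) :=
  {v | ∃ g ∈ J, ∀ i, v i = Rk.eval lam (g i)}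

/-- The spectrum of `J`: the points of the closed unit disc over which the fiber of `J` is not
all of `ℂ^d`. -/
def fiberSpectrum {d : ℕ} (J : Submodule ℂ (RkPow k d)) : Set ℂ :=
  {lam | lam ∈ Metric.closedBall (0 : ℂ) 1 ∧ fiber J lam ≠ Set.univ}

end

/-!
Multiplication by `z - lam` acts on `R_k^d / J`, which is a finite module over the commutative ring
`R_k` because closed `M_z`-invariant subspaces are `R_k`-submodules. A surjective endomorphism of
such a module is injective, so `lam` is outside the spectrum as soon as
`J + (z - lam) R_k^d = R_k^d`. For `|lam| < 1` the range of `M_z - lam` on `R_k` is the kernel of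
the evaluation at `lam`, so this equality says that the fiber of `J` over `lam` is `ℂ^d`. The
division by `z - lam` is carried out by the Neumann series of the backward shift `L`, which
converges because `‖L^n‖² = sup_j k_{n+j} / k_j` grows subexponentially.
-/

/-- Surjective endomorphisms of the finite module `P ⧸ N` are injective (Vasconcelos). -/
theorem mem_of_smul_mem_of_forall_exists_sub_smul_mem {S P : Type*} [CommRing S] [AddCommGroup P]
    [Module S P] [Module.Finite S P] (N : Submodule S P) {x : S}
    (hx : ∀ p, ∃ q, p - x • q ∈ N) {p : P} (hp : x • p ∈ N) : p ∈ N := by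
  have hsurj : Function.Surjective (LinearMap.lsmul S (P ⧸ N) x) := by
    intro y
    obtain ⟨p, rfl⟩ := N.mkQ_surjective y
    obtain ⟨q, hq⟩ := hx p
    exact ⟨N.mkQ q, ((Submodule.Quotient.eq N).2 hq).symm⟩
  have hinj := OrzechProperty.injective_of_surjective_endomorphism _ hsurj
  refine (Submodule.Quotient.mk_eq_zero N).1 (hinj ?_)
  rw [map_zero]
  exact (Submodule.Quotient.mk_eq_zero N).2 hp

noncomputable section

namespace Rk

section Hilbert

variable {k : WeightSeq}

theorem norm_sq_eq (f : Rk k) :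
    ‖f‖ ^ 2 = ∑' n, ‖PowerSeries.coeff n (f : PowerSeries ℂ)‖ ^ 2 / k n := by
  rw [norm_eq, Real.sq_sqrt (tsum_nonneg fun n => div_nonneg (sq_nonneg _) (k.pos n).le)]

theorem norm_coeff_le (f : Rk k) (n : ℕ) :
    ‖PowerSeries.coeff n (f : PowerSeries ℂ)‖ ≤ √(k n) * ‖f‖ := by
  have h : ‖PowerSeries.coeff n (f : PowerSeries ℂ)‖ ^ 2 / k n ≤ ‖f‖ ^ 2 :=
    norm_sq_eq f ▸ f.2.le_tsum n fun m _ => div_nonneg (sq_nonneg _) (k.pos m).le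
  refine le_of_sq_le_sq ?_ (by positivity)
  rwa [mul_pow, Real.sq_sqrt (k.pos n).le, ← div_le_iff₀' (k.pos n)]

variable (k) in
/-- The monomial `z^n` as an element of `R_k`. -/
def zPow (n : ℕ) : Rk k :=
  ⟨PowerSeries.X ^ n, summable_of_ne_finset_zero (s := {n}) fun m hm => by
    simp [PowerSeries.coeff_X_pow, Finset.notMem_singleton.1 hm]⟩

theorem coe_zPow (n : ℕ) : (zPow k n : PowerSeries ℂ) = PowerSeries.X ^ n := rfl

theorem norm_zPow_sq (n : ℕ) : ‖zPow k n‖ ^ 2 = (k n)⁻¹ := by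
  rw [norm_sq_eq, tsum_eq_single n fun m hm => by simp [coe_zPow, PowerSeries.coeff_X_pow, hm]]
  simp [coe_zPow, PowerSeries.coeff_X_pow]

theorem eval_smul_zPow_zero (lam c : ℂ) : eval lam (c • zPow k 0) = c := by
  rw [eval, tsum_eq_single 0 fun n hn => by simp [coe_zPow, PowerSeries.coeff_one, hn]]
  simp [coe_zPow]

theorem toL2_apply (f : Rk k) (n : ℕ) :
    toL2 k f n = PowerSeries.coeff n (f : PowerSeries ℂ) / (√(k n) : ℂ) := rfl

theorem toL2_surjective (k : WeightSeq) : Function.Surjective (toL2 k) := by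
  intro a
  have ha : Summable fun n => ‖a n‖ ^ 2 := by
    simpa using (lp.memℓp a).summable (by norm_num)
  have hmem : PowerSeries.mk (fun n => a n * (√(k n) : ℂ)) ∈ Rk k := ha.congr fun n => by
    rw [PowerSeries.coeff_mk, norm_mul, mul_pow, Complex.norm_real, Real.norm_eq_abs, sq_abs,
      Real.sq_sqrt (k.pos n).le, mul_div_cancel_right₀ _ (k.pos n).ne']
  refine ⟨⟨_, hmem⟩, ?_⟩
  ext n
  have hn : (√(k n) : ℂ) ≠ 0 := Complex.ofReal_ne_zero.2 (Real.sqrt_pos.2 (k.pos n)).ne'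
  rw [toL2_apply, PowerSeries.coeff_mk, mul_div_cancel_right₀ _ hn]

/-- The isometric isomorphism `f ↦ (f_n / √k_n)_n` of `R_k` onto `ℓ²`. -/
def l2Equiv (k : WeightSeq) : Rk k ≃ₗᵢ[ℂ] lp (fun _ : ℕ => ℂ) 2 :=
  LinearIsometryEquiv.ofSurjective ⟨toL2 k, fun _ => rfl⟩ (toL2_surjective k)

theorem l2Equiv_apply (f : Rk k) (n : ℕ) :
    l2Equiv k f n = PowerSeries.coeff n (f : PowerSeries ℂ) / (√(k n) : ℂ) := rfl

instance : CompleteSpace (Rk k) :=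
  (l2Equiv k).toIsometryEquiv.completeSpace

theorem hasSum_coeff_smul_zPow (f : Rk k) :
    HasSum (fun n => PowerSeries.coeff n (f : PowerSeries ℂ) • zPow k n) f := by
  have hterm (n : ℕ) : l2Equiv k (PowerSeries.coeff n (f : PowerSeries ℂ) • zPow k n)
      = lp.single 2 n (l2Equiv k f n) := by
    ext m
    rcases eq_or_ne m n with rfl | h
    · simp [l2Equiv_apply, coe_zPow, div_eq_mul_inv]
    · simp [l2Equiv_apply, coe_zPow, PowerSeries.coeff_X_pow, h]
  refine (l2Equiv k).toContinuousLinearEquiv.hasSum'.1 ?_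
  exact (lp.hasSum_single (by norm_num) (l2Equiv k f)).congr_fun hterm

end Hilbert

section Multiplication

variable {k : WeightSeq} (hk : IsBanachAlgebraRk k)

theorem Mz_zPow (n : ℕ) : Mz hk (zPow k n) = zPow k (n + 1) :=
  Subtype.ext (pow_succ' _ _).symm

theorem eq_top_of_isClosed_of_Mz_mem {I : Submodule ℂ (Rk k)} (hI : IsClosed (I : Set (Rk k)))
    (hone : zPow k 0 ∈ I) (hMz : ∀ f ∈ I, Mz hk f ∈ I) : I = ⊤ := by
  have hzPow (n : ℕ) : zPow k n ∈ I := by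
    induction n with
    | zero => exact hone
    | succ n ih => exact Mz_zPow hk n ▸ hMz _ ih
  refine eq_top_iff.2 fun f _ => hI.mem_of_tendsto (hasSum_coeff_smul_zPow f) ?_
  exact Eventually.of_forall fun s => I.sum_mem fun n _ => I.smul_mem _ (hzPow n)

include hk in
theorem mul_mem {f g : PowerSeries ℂ} (hf : f ∈ Rk k) (hg : g ∈ Rk k) : f * g ∈ Rk k := by
  obtain ⟨C, hC⟩ := hk
  obtain ⟨h, hfg, -⟩ := hC ⟨f, hf⟩ ⟨g, hg⟩
  exact (congrArg (· ∈ Rk k) hfg).mp h.2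

/-- The Banach algebra `R_k` as a subalgebra of the algebra of power series; its elements act on
`R_k` and on `R_k^d` by multiplication. -/
def subalgebra : Subalgebra ℂ (PowerSeries ℂ) :=
  (Rk k).toSubalgebra (zPow k 0).2 fun _ _ => mul_mem hk

instance : Module (subalgebra hk) (Rk k) where
  smul a f := ⟨a * f, mul_mem hk a.2 f.2⟩
  one_smul _ := Subtype.ext (one_mul _)
  mul_smul _ _ _ := Subtype.ext (mul_assoc _ _ _)
  smul_zero _ := Subtype.ext (mul_zero _)
  smul_add _ _ _ := Subtype.ext (mul_add _ _ _)
  add_smul _ _ _ := Subtype.ext (add_mul _ _ _)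
  zero_smul _ := Subtype.ext (zero_mul _)

instance : Module.Finite (subalgebra hk) (Rk k) :=
  Module.Finite.of_surjective (LinearMap.toSpanSingleton (subalgebra hk) (Rk k) (zPow k 0))
    fun f => ⟨⟨f, f.2⟩, Subtype.ext (mul_one _)⟩

/-- The bounded operator `a ↦ a f` on `R_k`. -/
def mulL (f : Rk k) : Rk k →L[ℂ] Rk k :=
  LinearMap.mkContinuousOfExistsBound
    { toFun := fun a => ⟨a * f, mul_mem hk a.2 f.2⟩
      map_add' := fun _ _ => Subtype.ext (add_mul _ _ _)
      map_smul' := fun _ _ => Subtype.ext (smul_mul_assoc _ _ _) }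
    (by
      obtain ⟨C, hC⟩ := hk
      refine ⟨C * ‖f‖, fun a => ?_⟩
      obtain ⟨h, hmul, hnorm⟩ := hC a f
      rw [mul_right_comm]
      exact (congrArg norm (Subtype.ext hmul)).symm.trans_le hnorm)

end Multiplication

section BackwardShift

variable {k : WeightSeq}

theorem norm_coeff_add_sq_div_le {n : ℕ} {c : ℝ} (hc : ∀ j, k (j + n) ≤ c * k j) (f : Rk k)
    (j : ℕ) : ‖PowerSeries.coeff (j + n) (f : PowerSeries ℂ)‖ ^ 2 / k j
      ≤ c * (‖PowerSeries.coeff (j + n) (f : PowerSeries ℂ)‖ ^ 2 / k (j + n)) := by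
  rw [← mul_div_assoc, div_le_div_iff₀ (k.pos j) (k.pos _), mul_right_comm, mul_comm]
  exact mul_le_mul_of_nonneg_right (hc j) (sq_nonneg _)

theorem summable_norm_coeff_add_sq_div {n : ℕ} {c : ℝ} (hc : ∀ j, k (j + n) ≤ c * k j)
    (f : Rk k) :
    Summable fun j => ‖PowerSeries.coeff (j + n) (f : PowerSeries ℂ)‖ ^ 2 / k j :=
  .of_nonneg_of_le (fun j => div_nonneg (sq_nonneg _) (k.pos j).le)
    (norm_coeff_add_sq_div_le hc f) (((summable_nat_add_iff n).2 f.2).mul_left c)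

theorem tsum_norm_coeff_add_sq_div_le {n : ℕ} {c : ℝ} (hc : ∀ j, k (j + n) ≤ c * k j)
    (f : Rk k) :
    ∑' j, ‖PowerSeries.coeff (j + n) (f : PowerSeries ℂ)‖ ^ 2 / k j ≤ c * ‖f‖ ^ 2 := by
  have hc0 : 0 ≤ c := (pos_of_mul_pos_left ((k.pos _).trans_le (hc 0)) (k.pos 0).le).le
  have htail := (summable_nat_add_iff n).2 f.2
  calc ∑' j, ‖PowerSeries.coeff (j + n) (f : PowerSeries ℂ)‖ ^ 2 / k j
      ≤ ∑' j, c * (‖PowerSeries.coeff (j + n) (f : PowerSeries ℂ)‖ ^ 2 / k (j + n)) :=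
        (summable_norm_coeff_add_sq_div hc f).tsum_le_tsum (norm_coeff_add_sq_div_le hc f)
          (htail.mul_left c)
    _ = c * ∑' j, ‖PowerSeries.coeff (j + n) (f : PowerSeries ℂ)‖ ^ 2 / k (j + n) :=
        tsum_mul_left
    _ ≤ c * ‖f‖ ^ 2 := by
        rw [norm_sq_eq]
        refine mul_le_mul_of_nonneg_left ?_ hc0
        exact tsum_comp_le_tsum_of_inj f.2 (fun j => div_nonneg (sq_nonneg _) (k.pos j).le)
          (add_left_injective n)

theorem norm_le_of_coeff_eq_coeff_add {n : ℕ} {b : ℝ} (hb : ∀ j, k (j + n) ≤ b * k j) {f g : Rk k}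
    (hfg : ∀ j, PowerSeries.coeff j (g : PowerSeries ℂ)
      = PowerSeries.coeff (j + n) (f : PowerSeries ℂ)) : ‖g‖ ≤ √b * ‖f‖ := by
  have hb0 : 0 ≤ b := (pos_of_mul_pos_left ((k.pos _).trans_le (hb 0)) (k.pos 0).le).le
  refine le_of_sq_le_sq ?_ (by positivity)
  rw [mul_pow, Real.sq_sqrt hb0, norm_sq_eq g]
  simp only [hfg]
  exact tsum_norm_coeff_add_sq_div_le hb f

/-- The backward shift `L : f ↦ (f - f(0)) / z` on `R_k`, a bounded left inverse of `M_z`. -/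
def backwardShift {c : ℝ} (hc : ∀ j, k (j + 1) ≤ c * k j) : Rk k →L[ℂ] Rk k :=
  LinearMap.mkContinuous
    { toFun := fun f => ⟨PowerSeries.mk fun j => PowerSeries.coeff (j + 1) (f : PowerSeries ℂ),
        (summable_norm_coeff_add_sq_div hc f).congr fun j => by rw [PowerSeries.coeff_mk]⟩
      map_add' := fun f g => Subtype.ext <| by ext; simp
      map_smul' := fun a f => Subtype.ext <| by ext; simp }
    (√c) fun f => norm_le_of_coeff_eq_coeff_add hc fun j =>
      PowerSeries.coeff_mk j fun i => PowerSeries.coeff (i + 1) (f : PowerSeries ℂ)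

variable {c : ℝ} (hc : ∀ j, k (j + 1) ≤ c * k j)

theorem coeff_backwardShift (f : Rk k) (j : ℕ) :
    PowerSeries.coeff j (backwardShift hc f : PowerSeries ℂ)
      = PowerSeries.coeff (j + 1) (f : PowerSeries ℂ) :=
  PowerSeries.coeff_mk j fun i => PowerSeries.coeff (i + 1) (f : PowerSeries ℂ)

theorem coeff_backwardShift_pow (n : ℕ) (f : Rk k) (j : ℕ) :
    PowerSeries.coeff j ((backwardShift hc ^ n) f : PowerSeries ℂ)
      = PowerSeries.coeff (j + n) (f : PowerSeries ℂ) := by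
  induction n generalizing j with
  | zero => rfl
  | succ n ih =>
    rw [pow_succ', mul_apply_eq_comp, coeff_backwardShift, ih, add_right_comm, add_assoc]

theorem norm_backwardShift_pow_le {n : ℕ} {b : ℝ} (hb : ∀ j, k (j + n) ≤ b * k j) :
    ‖backwardShift hc ^ n‖ ≤ √b :=
  ContinuousLinearMap.opNorm_le_bound _ (Real.sqrt_nonneg b) fun f =>
    norm_le_of_coeff_eq_coeff_add hb (coeff_backwardShift_pow hc n f)

theorem backwardShift_Mz (hk : IsBanachAlgebraRk k) (f : Rk k) :
    backwardShift hc (Mz hk f) = f :=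
  Subtype.ext <| PowerSeries.ext fun n =>
    (coeff_backwardShift hc _ n).trans (PowerSeries.coeff_succ_X_mul n _)

end BackwardShift

section Evaluation

variable {k : WeightSeq} {c : ℝ} {hc : ∀ j, k (j + 1) ≤ c * k j} {lam : ℂ}

/-- As `f_n = (L^n f)_0`, the terms of `f(lam)` are dominated by those of the Neumann series. -/
theorem summable_coeff_mul_pow (hL : Summable fun n => ‖(lam • backwardShift hc) ^ n‖)
    (f : Rk k) : Summable fun n => PowerSeries.coeff n (f : PowerSeries ℂ) * lam ^ n := by
  refine .of_norm_bounded ((hL.mul_right ‖f‖).mul_left √(k 0)) fun n => ?_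
  have hcoeff : PowerSeries.coeff n (f : PowerSeries ℂ) * lam ^ n
      = PowerSeries.coeff 0 (((lam • backwardShift hc) ^ n) f : PowerSeries ℂ) := by
    rw [smul_pow, smul_apply, Submodule.coe_smul, map_smul,
      coeff_backwardShift_pow, zero_add, smul_eq_mul, mul_comm]
  rw [hcoeff]
  exact (norm_coeff_le _ 0).trans (by gcongr; exact ContinuousLinearMap.le_opNorm _ f)

theorem isLinearMap_eval (hL : Summable fun n => ‖(lam • backwardShift hc) ^ n‖) :
    IsLinearMap ℂ (eval (k := k) lam) where
  map_add f g := by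
    simp only [eval, Submodule.coe_add, map_add, add_mul]
    exact (summable_coeff_mul_pow hL f).tsum_add (summable_coeff_mul_pow hL g)
  map_smul a f := by
    simp only [eval, Submodule.coe_smul, map_smul, smul_eq_mul, mul_assoc, tsum_mul_left]

theorem eval_eq_coeff_zero_add (hL : Summable fun n => ‖(lam • backwardShift hc) ^ n‖)
    (f : Rk k) : eval lam f
      = PowerSeries.coeff 0 (f : PowerSeries ℂ) + lam * eval lam (backwardShift hc f) := by
  rw [eval, (summable_coeff_mul_pow hL f).tsum_eq_zero_add, pow_zero, mul_one, eval,
    ← tsum_mul_left]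
  simp only [coeff_backwardShift, pow_succ', mul_left_comm]

theorem eval_Mz (hk : IsBanachAlgebraRk k)
    (hL : Summable fun n => ‖(lam • backwardShift hc) ^ n‖) (f : Rk k) :
    eval lam (Mz hk f) = lam * eval lam f := by
  have hzero : PowerSeries.coeff 0 (Mz hk f : PowerSeries ℂ) = 0 :=
    PowerSeries.coeff_zero_X_mul _
  rw [eval_eq_coeff_zero_add hL, hzero, zero_add, backwardShift_Mz]

theorem eq_zero_of_backwardShift_eq_zero_of_eval_eq_zero
    (hL : Summable fun n => ‖(lam • backwardShift hc) ^ n‖) {f : Rk k}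
    (hf : backwardShift hc f = 0) (heval : eval lam f = 0) : f = 0 := by
  have hcoeff := eval_eq_coeff_zero_add hL f
  rw [heval, hf, (isLinearMap_eval hL).map_zero, mul_zero, add_zero] at hcoeff
  refine Subtype.ext (PowerSeries.ext fun n => ?_)
  cases n with
  | zero => exact hcoeff.symm
  | succ n => rw [← coeff_backwardShift hc, hf]; rfl

/-- If `f(lam) = 0`, then the quotient `f / (z - lam)` is the solution `(1 - lam L)⁻¹ L f` of
`h - lam L h = L f`. -/
theorem exists_smul_sub_Mz_eq_iff (hk : IsBanachAlgebraRk k)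
    (hL : Summable fun n => ‖(lam • backwardShift hc) ^ n‖) {f : Rk k} :
    (∃ g, lam • g - Mz hk g = f) ↔ eval lam f = 0 := by
  have heval (g : Rk k) : eval lam (lam • g - Mz hk g) = 0 := by
    rw [(isLinearMap_eval hL).map_sub, (isLinearMap_eval hL).map_smul, eval_Mz hk hL,
      smul_eq_mul, sub_self]
  refine ⟨fun ⟨g, hg⟩ => hg ▸ heval g, fun hf => ?_⟩
  set h : Rk k := (∑' n, (lam • backwardShift hc) ^ n) (backwardShift hc f)
  have hh : h - lam • backwardShift hc h = backwardShift hc f :=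
    congrArg (· (backwardShift hc f)) hL.of_norm.one_sub_mul_tsum_pow
  refine ⟨-h, sub_eq_zero.1 (eq_zero_of_backwardShift_eq_zero_of_eval_eq_zero hL ?_ ?_)⟩
  · rw [map_sub, map_sub, map_smul, map_neg, map_neg, map_neg, backwardShift_Mz, ← hh]
    module
  · rw [(isLinearMap_eval hL).map_sub, heval, hf, sub_self]

end Evaluation

section Growth

variable {k : WeightSeq}

theorem le_norm_Mz_sq_mul (hk : IsBanachAlgebraRk k) (j : ℕ) :
    k j ≤ ‖Mz hk‖ ^ 2 * k (j + 1) := by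
  have h : ‖zPow k (j + 1)‖ ^ 2 ≤ ‖Mz hk‖ ^ 2 * ‖zPow k j‖ ^ 2 := by
    rw [← Mz_zPow hk, ← mul_pow]
    gcongr
    exact (Mz hk).le_opNorm _
  rwa [norm_zPow_sq, norm_zPow_sq, ← div_eq_mul_inv, le_div_iff₀ (k.pos j),
    inv_mul_le_iff₀ (k.pos _), mul_comm] at h

theorem le_norm_Mz_sq_pow_mul (hk : IsBanachAlgebraRk k) (m j : ℕ) :
    k j ≤ (‖Mz hk‖ ^ 2) ^ m * k (j + m) := by
  induction m with
  | zero => simp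
  | succ m ih =>
    calc k j ≤ (‖Mz hk‖ ^ 2) ^ m * k (j + m) := ih
      _ ≤ (‖Mz hk‖ ^ 2) ^ m * (‖Mz hk‖ ^ 2 * k (j + m + 1)) := by
        gcongr
        exact le_norm_Mz_sq_mul hk _
      _ = (‖Mz hk‖ ^ 2) ^ (m + 1) * k (j + (m + 1)) := by
        rw [pow_succ _ m, mul_assoc, add_assoc]

variable {R : ℝ}
  (hm : Tendsto (fun n : ℕ => (⨅ j : ℕ, k j / k (n + j)) ^ (1 / (n : ℝ))) atTop (𝓝 (R ^ 2)))

include hm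

theorem eventually_le_inv_pow_sq_mul {r : ℝ} (hr0 : 0 < r) (hr : r < R) :
    ∀ᶠ n in atTop, ∀ j, k (j + n) ≤ (r⁻¹ ^ n) ^ 2 * k j := by
  have hroot : ∀ᶠ n : ℕ in atTop, r ^ 2 < (⨅ j : ℕ, k j / k (n + j)) ^ (1 / (n : ℝ)) :=
    hm.eventually_const_lt (by gcongr)
  filter_upwards [hroot, eventually_ne_atTop 0] with n hn hn0 j
  have hnonneg (i : ℕ) : 0 ≤ k i / k (n + i) := (div_pos (k.pos _) (k.pos _)).le
  have hpow : (r ^ 2) ^ n ≤ ⨅ i : ℕ, k i / k (n + i) := by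
    have h := pow_le_pow_left₀ (by positivity) hn.le n
    rwa [one_div, Real.rpow_inv_natCast_pow (Real.iInf_nonneg hnonneg) hn0] at h
  have hj : (r ^ 2) ^ n ≤ k j / k (n + j) :=
    hpow.trans (ciInf_le ⟨0, Set.forall_mem_range.2 hnonneg⟩ j)
  rw [le_div_iff₀ (k.pos _), add_comm n j, ← le_inv_mul_iff₀ (by positivity)] at hj
  rwa [inv_pow, inv_pow, pow_right_comm]

theorem exists_forall_succ_le_mul (hk : IsBanachAlgebraRk k) (hR : 0 < R) :
    ∃ c, ∀ j, k (j + 1) ≤ c * k j := by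
  obtain ⟨r, hr0, hr⟩ := exists_between hR
  obtain ⟨n, hn, hn1⟩ :=
    ((eventually_le_inv_pow_sq_mul hm hr0 hr).and (eventually_ge_atTop 1)).exists
  obtain ⟨m, rfl⟩ := Nat.exists_eq_add_of_le hn1
  refine ⟨(‖Mz hk‖ ^ 2) ^ m * (r⁻¹ ^ (1 + m)) ^ 2, fun j => ?_⟩
  calc k (j + 1) ≤ (‖Mz hk‖ ^ 2) ^ m * k (j + 1 + m) := le_norm_Mz_sq_pow_mul hk m (j + 1)
    _ = (‖Mz hk‖ ^ 2) ^ m * k (j + (1 + m)) := by rw [add_assoc]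
    _ ≤ (‖Mz hk‖ ^ 2) ^ m * ((r⁻¹ ^ (1 + m)) ^ 2 * k j) := by gcongr; exact hn j
    _ = _ := (mul_assoc _ _ _).symm

theorem summable_norm_smul_backwardShift_pow {c : ℝ} (hc : ∀ j, k (j + 1) ≤ c * k j) {lam : ℂ}
    (hlam : ‖lam‖ < R) : Summable fun n => ‖(lam • backwardShift hc) ^ n‖ := by
  obtain ⟨r, hlr, hr⟩ := exists_between hlam
  have hr0 : 0 < r := (norm_nonneg _).trans_lt hlr
  have hgeom : Summable fun n : ℕ => (‖lam‖ * r⁻¹) ^ n :=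
    summable_geometric_of_lt_one (by positivity) ((mul_inv_lt_iff₀ hr0).2 (by rwa [one_mul]))
  refine hgeom.of_norm_bounded_eventually_nat ?_
  filter_upwards [eventually_le_inv_pow_sq_mul hm hr0 hr] with n hn
  have hL : ‖backwardShift hc ^ n‖ ≤ r⁻¹ ^ n :=
    (norm_backwardShift_pow_le hc hn).trans_eq (Real.sqrt_sq (by positivity))
  rw [norm_norm, smul_pow, norm_smul, norm_pow, mul_pow]
  gcongr

end Growth

end Rk

namespace RkPow

variable {k : WeightSeq} (hk : IsBanachAlgebraRk k) {d : ℕ}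

/-- The bounded operator `a ↦ a f` from `R_k` to `R_k^d`. -/
def mulL (f : RkPow k d) : Rk k →L[ℂ] RkPow k d :=
  (PiLp.continuousLinearEquiv 2 ℂ (fun _ : Fin d => Rk k)).symm.toContinuousLinearMap ∘L
    ContinuousLinearMap.pi fun i => Rk.mulL hk (f i)

theorem mulL_zPow_zero (f : RkPow k d) : mulL hk f (Rk.zPow k 0) = f := by
  ext i : 1
  exact Subtype.ext (one_mul _)

theorem mulL_Mz (f : RkPow k d) (a : Rk k) : mulL hk f (Mz hk a) = MzPow hk d (mulL hk f a) := by
  ext i : 1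
  exact Subtype.ext (mul_assoc _ _ _)

theorem smul_sub_MzPow_eq (lam : ℂ) (f : RkPow k d) :
    lam • f - MzPow hk d f =
      (algebraMap ℂ (Rk.subalgebra hk) lam - ⟨PowerSeries.X, Rk.X_mem k⟩) • f := by
  ext i : 1
  refine Subtype.ext ?_
  change lam • (f i : PowerSeries ℂ) - PowerSeries.X * (f i : PowerSeries ℂ)
    = (algebraMap ℂ (PowerSeries ℂ) lam - PowerSeries.X) * (f i : PowerSeries ℂ)
  rw [sub_mul, Algebra.smul_def]

theorem exists_smul_sub_MzPow_eq_iff {c : ℝ} {hc : ∀ j, k (j + 1) ≤ c * k j} {lam : ℂ}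
    (hL : Summable fun n => ‖(lam • Rk.backwardShift hc) ^ n‖) {f : RkPow k d} :
    (∃ g, lam • g - MzPow hk d g = f) ↔ ∀ i, Rk.eval lam (f i) = 0 := by
  simp only [← Rk.exists_smul_sub_Mz_eq_iff hk hL]
  constructor
  · rintro ⟨g, rfl⟩ i
    exact ⟨g i, rfl⟩
  · intro h
    choose g hg using h
    refine ⟨WithLp.toLp 2 g, ?_⟩
    ext i : 1
    exact hg i

end RkPow

theorem fiber_eq_univ_iff {k : WeightSeq} {d : ℕ} {J : Submodule ℂ (RkPow k d)} {lam : ℂ} :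
    fiber J lam = Set.univ ↔
      ∀ f : RkPow k d, ∃ g ∈ J, ∀ i, Rk.eval lam (g i) = Rk.eval lam (f i) := by
  constructor
  · intro h f
    obtain ⟨g, hg, hfg⟩ : (fun i => Rk.eval lam (f i)) ∈ fiber J lam := h ▸ Set.mem_univ _
    exact ⟨g, hg, fun i => (hfg i).symm⟩
  · refine fun h => Set.eq_univ_of_forall fun v => ?_
    obtain ⟨g, hg, hgv⟩ := h (WithLp.toLp 2 fun i => v i • Rk.zPow k 0)
    exact ⟨g, hg, fun i => ((hgv i).trans (Rk.eval_smul_zPow_zero lam (v i))).symm⟩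

section Quotient

variable {k : WeightSeq} (hk : IsBanachAlgebraRk k) {d : ℕ} {J : Submodule ℂ (RkPow k d)}
  {lam : ℂ}

theorem exists_sub_smul_sub_MzPow_mem_iff {c : ℝ} {hc : ∀ j, k (j + 1) ≤ c * k j}
    (hL : Summable fun n => ‖(lam • Rk.backwardShift hc) ^ n‖) (f : RkPow k d) :
    (∃ g, f - (lam • g - MzPow hk d g) ∈ J) ↔
      ∃ g ∈ J, ∀ i, Rk.eval lam (g i) = Rk.eval lam (f i) := by
  have hdiv (g : RkPow k d) : (∀ i, Rk.eval lam (g i) = Rk.eval lam (f i)) ↔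
      ∃ h, lam • h - MzPow hk d h = f - g := by
    rw [RkPow.exists_smul_sub_MzPow_eq_iff hk hL]
    refine forall_congr' fun i => ?_
    rw [PiLp.sub_apply, (Rk.isLinearMap_eval hL).map_sub, sub_eq_zero, eq_comm]
  simp only [hdiv]
  constructor
  · rintro ⟨g, hg⟩
    exact ⟨_, hg, g, (sub_sub_cancel _ _).symm⟩
  · rintro ⟨g, hg, h, hh⟩
    exact ⟨h, by rwa [hh, sub_sub_cancel]⟩

variable (hJ : ∀ f ∈ J, MzPow hk d f ∈ J)

theorem surjective_sub_quotMz_iff :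
    Function.Surjective (algebraMap ℂ (RkPow k d ⧸ J →L[ℂ] RkPow k d ⧸ J) lam - quotMz hk J hJ) ↔
      ∀ f, ∃ g, f - (lam • g - MzPow hk d g) ∈ J := by
  simp only [Function.Surjective, J.mkQ_surjective.forall, J.mkQ_surjective.exists]
  refine forall_congr' fun f => exists_congr fun g => ?_
  rw [eq_comm]
  exact Submodule.Quotient.eq J

variable (hJclosed : IsClosed (J : Set (RkPow k d)))

include hJ hJclosed

theorem mulL_mem_of_isClosed {f : RkPow k d} (hf : f ∈ J) (a : Rk k) :
    RkPow.mulL hk f a ∈ J := by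
  have htop : J.comap (RkPow.mulL hk f).toLinearMap = ⊤ := by
    refine Rk.eq_top_of_isClosed_of_Mz_mem hk (hJclosed.preimage (RkPow.mulL hk f).continuous)
      ?_ fun b hb => ?_
    · exact (congrArg (· ∈ J) (RkPow.mulL_zPow_zero hk f)).mpr hf
    · exact (congrArg (· ∈ J) (RkPow.mulL_Mz hk f b)).mpr (hJ _ hb)
  exact Submodule.mem_comap.1 (htop ▸ Submodule.mem_top)

/-- A closed `M_z`-invariant subspace of `R_k^d`, as a submodule over the algebra `R_k`. -/
def closedInvariantSubmodule : Submodule (Rk.subalgebra hk) (RkPow k d) :=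
  { J.toAddSubmonoid with
    smul_mem' := fun a _ hf => mulL_mem_of_isClosed hk hJ hJclosed hf ⟨a, a.2⟩ }

theorem mem_of_smul_sub_MzPow_mem (hsurj : ∀ f, ∃ g, f - (lam • g - MzPow hk d g) ∈ J)
    {f : RkPow k d} (hf : lam • f - MzPow hk d f ∈ J) : f ∈ J := by
  simp only [RkPow.smul_sub_MzPow_eq] at hsurj hf
  exact mem_of_smul_mem_of_forall_exists_sub_smul_mem
    (closedInvariantSubmodule hk hJ hJclosed) hsurj hf

theorem isUnit_sub_quotMz_iff_surjective :
    IsUnit (algebraMap ℂ (RkPow k d ⧸ J →L[ℂ] RkPow k d ⧸ J) lam - quotMz hk J hJ) ↔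
      Function.Surjective
        (algebraMap ℂ (RkPow k d ⧸ J →L[ℂ] RkPow k d ⧸ J) lam - quotMz hk J hJ) := by
  rw [ContinuousLinearMap.isUnit_iff_bijective]
  refine ⟨And.right, fun hsurj => ⟨(injective_iff_map_eq_zero _).2 fun q hq => ?_, hsurj⟩⟩
  obtain ⟨f, rfl⟩ := J.mkQ_surjective q
  exact (Submodule.Quotient.mk_eq_zero J).2 <| mem_of_smul_sub_MzPow_mem hk hJ hJclosed
    ((surjective_sub_quotMz_iff hk hJ).1 hsurj) ((Submodule.Quotient.mk_eq_zero J).1 hq)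

end Quotient

end

/-- The square comes from `inf_j k_j / k_{n+j} = ‖L^n‖⁻²` for the backward shift `L`, whose spectral
radius is therefore `R⁻¹`. -/
theorem theorem5p3_general {k : WeightSeq} (hk : IsBanachAlgebraRk k) {R : ℝ}
    (hm : Tendsto (fun n : ℕ => (⨅ j : ℕ, k j / k (n + j)) ^ (1 / (n : ℝ))) atTop (𝓝 (R ^ 2)))
    {d : ℕ} {J : Submodule ℂ (RkPow k d)} (hJclosed : IsClosed (J : Set (RkPow k d)))
    (hJ : ∀ f ∈ J, MzPow hk d f ∈ J) {lam : ℂ} (hlam : ‖lam‖ < R) :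
    fiber J lam ≠ Set.univ ↔ lam ∈ spectrum ℂ (quotMz hk J hJ) := by
  obtain ⟨c, hc⟩ := Rk.exists_forall_succ_le_mul hm hk ((norm_nonneg lam).trans_lt hlam)
  have hL := Rk.summable_norm_smul_backwardShift_pow hm hc hlam
  rw [ne_eq, spectrum.mem_iff, isUnit_sub_quotMz_iff_surjective hk hJ hJclosed,
    surjective_sub_quotMz_iff hk hJ, fiber_eq_univ_iff]
  simp only [exists_sub_smul_sub_MzPow_mem_iff hk hL]

theorem theorem5p3 (k : WeightSeq) (hk : IsBanachAlgebraRk k)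
    (hm : Tendsto (fun n : ℕ => (⨅ j : ℕ, k j / k (n + j)) ^ (1 / (n : ℝ))) atTop (𝓝 1))
    (hk1 : Tendsto (fun n : ℕ => (k n) ^ (1 / (n : ℝ))) atTop (𝓝 1))
    (d : ℕ) (J : Submodule ℂ (RkPow k d)) (hJclosed : IsClosed (J : Set (RkPow k d)))
    (hJ : ∀ f ∈ J, MzPow hk d f ∈ J) :
    fiberSpectrum J ∩ Metric.ball (0 : ℂ) 1
      = spectrum ℂ (quotMz hk J hJ) ∩ Metric.ball (0 : ℂ) 1 := by
  ext lam
  refine and_congr_left fun hlam => (and_iff_right (Metric.ball_subset_closedBall hlam)).trans ?_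
  exact theorem5p3_general hk (by rwa [one_pow]) hJclosed hJ (mem_ball_zero_iff.1 hlam)
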